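/- Rings and algebras are associative and need not have an identity element. Let $K$ be a field of characteristic $0$ and let $R$ be a $K$-algebra with a $K$-linear derivation $d\colon R\to R$ that is surjective and locally nilpotent (for each $r\in R$ there is $n\ge 1$ with $d^n(r)=0$). Put $R^d=\ker d$ and $T=\ker d^2$. Assume that $R$ is generated as a $K$-algebra by $T$ and that $R^d$ is commutative. Then the Jacobson radical $J(R)$ of $R$ is locally nilpotent, i.e. every finitely generated subring of $J(R)$ is nilpotent. Moreover, $$J(R)^2\subseteq P(R^d)\langle T\rangle^*,$$ where $P(R^d)$ is the prime radical (the intersection of all prime ideals) of the ring $R^d$, and $P(R^d)\langle T\rangle^*$ is the set of all finite sums of elements $p\,t_1t_2\cdots t_n$ with $n\ge 0$, $p\in P(R^d)$ and $t_1,\dots,t_n\in T$. -/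

import Mathlib

/-! Rings are associative and need not have an identity element. -/

section

variable {R : Type*} [NonUnitalRing R]

/-- The Jacobson radical of a ring: its largest quasi-regular two-sided ideal, given as the sum
of all the two-sided ideals that consist of quasi-regular elements. -/
def jacobsonRadical (R : Type*) [NonUnitalRing R] : TwoSidedIdeal R :=
  sSup {I : TwoSidedIdeal R | ∀ x ∈ I, IsQuasiregular x}

/-- A two-sided ideal `Q` is prime if it is proper and `A B ⊆ Q` implies `A ⊆ Q` or `B ⊆ Q`
for two-sided ideals `A`, `B`. -/
def IsPrimeTwoSided (Q : TwoSidedIdeal R) : Prop :=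
  Q ≠ ⊤ ∧ ∀ A B : TwoSidedIdeal R, (∀ a ∈ A, ∀ b ∈ B, a * b ∈ Q) → A ≤ Q ∨ B ≤ Q

/-- The prime radical of a ring: the intersection of its prime ideals. -/
def primeRadical (R : Type*) [NonUnitalRing R] : TwoSidedIdeal R :=
  sInf {Q : TwoSidedIdeal R | IsPrimeTwoSided Q}

/-- The product `r t₁ t₂ ⋯ tₙ` for `l = [t₁, …, tₙ]`; it is `r` if `l` is empty. -/
def mulWord (r : R) (l : List R) : R := l.foldl (· * ·) r

/-- A subring `S` is nilpotent: for some `n`, all products of `n + 1` elements of `S` vanish. -/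
def IsNilpotentSubring (S : NonUnitalSubring R) : Prop :=
  ∃ n : ℕ, ∀ s ∈ S, ∀ l : List R, (∀ t ∈ l, t ∈ S) → l.length = n → mulWord s l = 0

/-- An ideal is locally nilpotent if all of its finitely generated subrings are nilpotent. -/
def IsLocallyNilpotent (I : TwoSidedIdeal R) : Prop :=
  ∀ F : Finset R, (∀ x ∈ F, x ∈ I) → IsNilpotentSubring (NonUnitalSubring.closure (F : Set R))

/-- `P⟨T⟩*`: the finite sums of elements `r ω` with `r ∈ P` and `ω` a (possibly empty) word in
elements of `T`, as an additive subgroup of `R`. -/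
def skewStar (P T : Set R) : AddSubgroup R :=
  AddSubgroup.closure {x | ∃ r ∈ P, ∃ l : List R, (∀ t ∈ l, t ∈ T) ∧ x = mulWord r l}

/-- The subalgebra `R^d = ker d` of constants of a derivation `d`. -/
def constants {K : Type*} [Field K] [Module K R] (d : R →ₗ[K] R)
    (hd : ∀ x y, d (x * y) = d x * y + x * d y) : NonUnitalSubalgebra K R where
  carrier := {r | d r = 0}
  add_mem' {a b} ha hb := by
    simp only [Set.mem_ofPred_eq] at *
    rw [map_add, ha, hb, add_zero]
  zero_mem' := map_zero d
  mul_mem' {a b} ha hb := by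
    simp only [Set.mem_ofPred_eq] at *
    rw [hd, ha, hb, zero_mul, mul_zero, add_zero]
  smul_mem' c x hx := by
    simp only [Set.mem_ofPred_eq] at *
    rw [map_smul, hx, smul_zero]

end

/-! Let N be the set of nilpotent constants; since R^d is commutative, this is its prime radical
(`image_primeRadical_eq`). Nilpotency and the Jacobson radical are handled in the unitization of R.
Call d^n(r) the leading coefficient of r when d^(n+1)(r) = 0, and write [t,x] = tx - xt.

The set N⟨T⟩* is a right ideal whose finite subsets generate nilpotent rings. For t in T, [t,·] maps
constants to constants because dt is a constant, and in characteristic 0 it preserves N. In a long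
product of elements of N⟨T⟩*, the factors from N can be collected on the left at the cost of
iterated commutators. Many of these have small order, hence lie in a fixed finite set of commuting
nilpotents, and the product vanishes (`exists_list_prod_eq_zero_of_commutator_mem`). It follows that
N lies in the Jacobson radical.

Conversely, leading coefficients of elements of J lie in N (`leadingCoeff_mem_nilConstants`): in r +
y + yr = 0, repeated multiplication by the leading coefficient p of r lowers the degree of y until a
power of p is seen to vanish.

Finally RJ ⊆ N⟨T⟩* (`mul_mem_skewStar_of_mem_jacobson`), by induction on the degree of r in J. Since
d is surjective, R is spanned by words a b t₁⋯tₙ with a, b constant. The letters tᵢ can be moved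
past r, and surjectivity supplies u such that br - pu has smaller degree. Both conclusions follow
from this inclusion. -/

/-! ### Nilpotency of products in unital rings -/

section UnitalRing

variable {S : Type*} [Ring S]

/-- Long enough products of elements of a finite set of commuting nilpotent elements vanish. -/
theorem exists_list_prod_eq_zero_of_finite {U : Set S} (hU : U.Finite)
    (hcomm : ∀ x ∈ U, ∀ y ∈ U, x * y = y * x) (hnil : ∀ x ∈ U, IsNilpotent x) :
    ∃ e : ℕ, ∀ L : List S, (∀ x ∈ L, x ∈ U) → L.length = e → L.prod = 0 := by
  induction U, hU using Set.Finite.induction_on with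
  | empty =>
    refine ⟨1, fun L hL hlen => ?_⟩
    obtain ⟨x, rfl⟩ := List.length_eq_one_iff.1 hlen
    exact absurd (hL x (by simp)) (by simp)
  | @insert u U _ _ ih =>
    obtain ⟨e, he⟩ := ih (fun x hx y hy => hcomm x (.inr hx) y (.inr hy))
      (fun x hx => hnil x (.inr hx))
    obtain ⟨k, hk⟩ := hnil u (.inl rfl)
    have split : ∀ L : List S, (∀ x ∈ L, x ∈ insert u U) → ∃ j, ∃ L' : List S,
        (∀ x ∈ L', x ∈ U) ∧ j + L'.length = L.length ∧ L.prod = u ^ j * L'.prod := by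
      intro L
      induction L with
      | nil => exact fun _ => ⟨0, [], by simp⟩
      | cons x L ihL =>
        intro hL
        obtain ⟨j, L', hL', hlen, hprod⟩ := ihL fun y hy => hL y (by simp [hy])
        rcases hL x (by simp) with rfl | hx
        · exact ⟨j + 1, L', hL', by simp; omega, by rw [List.prod_cons, hprod, pow_succ', mul_assoc]⟩
        · refine ⟨j, x :: L', by simpa [hx] using hL', by simp; omega, ?_⟩
          have hxu : Commute x u := hcomm x (.inr hx) u (.inl rfl)
          rw [List.prod_cons, hprod, List.prod_cons, ← mul_assoc, ← mul_assoc,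
            (hxu.pow_right j).eq]
    -- With all copies of u moved to the front, either at least k of them occur or more than e
    -- factors from U remain.
    refine ⟨k + e, fun L hL hlen => ?_⟩
    obtain ⟨j, L', hL', hlen', hprod⟩ := split L hL
    rw [hprod]
    by_cases hj : k ≤ j
    · rw [pow_eq_zero_of_le hj hk, zero_mul]
    · rw [← List.take_append_drop e L', List.prod_append,
        he (L'.take e) (fun x hx => hL' x (List.mem_of_mem_take hx)) (by simp; omega),
        zero_mul, mul_zero]

/-! ### Collecting factors to the left by commutators. -/

/-- The elements obtained from `Q` by applying exactly `i` commutators with elements of `E`. -/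
def iteratedCommutators (Q E : Set S) : ℕ → Set S
  | 0 => Q
  | i + 1 => Set.image2 (fun t v => t * v - v * t) E (iteratedCommutators Q E i)

theorem iteratedCommutators_finite {Q E : Set S} (hQ : Q.Finite) (hE : E.Finite) (i : ℕ) :
    (iteratedCommutators Q E i).Finite := by
  induction i with
  | zero => exact hQ
  | succ i ih => exact hE.image2 _ ih

theorem iteratedCommutators_subset {Q E N : Set S} (hQ : Q ⊆ N)
    (hE : ∀ t ∈ E, ∀ v ∈ N, t * v - v * t ∈ N) (i : ℕ) : iteratedCommutators Q E i ⊆ N := by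
  induction i with
  | zero => exact hQ
  | succ i ih =>
    rintro _ ⟨t, ht, v, hv, rfl⟩
    exact hE t ht v (ih hv)

/-- `CommutatorProd Q E n m x`: `x` is a product of `n` iterated commutators of total
order at most `m`. -/
inductive CommutatorProd (Q E : Set S) : ℕ → ℕ → S → Prop
  | one (m : ℕ) : CommutatorProd Q E 0 m 1
  | cons {n m i : ℕ} {v x : S} (hv : v ∈ iteratedCommutators Q E i)
      (hx : CommutatorProd Q E n m x) : CommutatorProd Q E (n + 1) (m + i) (v * x)

theorem CommutatorProd.mono {Q E : Set S} {n m m' : ℕ} {x : S} (h : CommutatorProd Q E n m x)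
    (hm : m ≤ m') : CommutatorProd Q E n m' x := by
  induction h generalizing m' with
  | one => exact .one _
  | @cons n m i v x hv _ ih =>
    obtain ⟨k, rfl⟩ := Nat.exists_eq_add_of_le hm
    have := CommutatorProd.cons hv (ih (Nat.le_add_right m k))
    rwa [show m + i + k = m + k + i by omega]

/-- The commutator with an element of `E` raises the total order by one. -/
theorem CommutatorProd.commutator_mem {Q E : Set S} {n m : ℕ} {x : S}
    (h : CommutatorProd Q E n m x) {t : S} (ht : t ∈ E) :
    t * x - x * t ∈ AddSubgroup.closure {y | CommutatorProd Q E n (m + 1) y} := by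
  induction h with
  | one => simp
  | @cons n m i v x hv hx ih =>
    have key : t * (v * x) - v * x * t = (t * v - v * t) * x + v * (t * x - x * t) := by
      noncomm_ring
    rw [key]
    refine add_mem (AddSubgroup.subset_closure ?_) ?_
    · have : (t * v - v * t) ∈ iteratedCommutators Q E (i + 1) := ⟨t, ht, v, hv, rfl⟩
      exact CommutatorProd.cons (m := m) this hx
    · generalize t * x - x * t = c at ih
      induction ih using AddSubgroup.closure_induction with
      | mem y hy =>
        refine AddSubgroup.subset_closure ?_
        have := CommutatorProd.cons hv hy
        rwa [show m + i + 1 = m + 1 + i by omega]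
      | zero => simp
      | add y z _ _ hy hz => rw [mul_add]; exact add_mem hy hz
      | neg y _ hy => rw [mul_neg]; exact neg_mem hy

/-- A product of `n` iterated commutators of total order at most `m` has at least `j` factors of
order less than `k` when `j * k + m ≤ n * k`. -/
theorem CommutatorProd.exists_factor {Q E : Set S}
    (hcomm : ∀ i j, ∀ x ∈ iteratedCommutators Q E i, ∀ y ∈ iteratedCommutators Q E j,
      x * y = y * x) {k n m : ℕ} (hk : 0 < k) {x : S} (h : CommutatorProd Q E n m x) (j : ℕ)
    (hj : j * k + m ≤ n * k) :
    ∃ L : List S, (∀ y ∈ L, ∃ i < k, y ∈ iteratedCommutators Q E i) ∧ L.length = j ∧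
      ∃ y, x = L.prod * y := by
  induction h generalizing j with
  | one m =>
    rcases j with _ | j
    · exact ⟨[], by simp, rfl, 1, by simp⟩
    · exfalso
      rw [zero_mul, add_mul] at hj
      omega
  | @cons n m i v x hv hx ih =>
    by_cases hi : i < k
    · rcases j with _ | j
      · exact ⟨[], by simp, rfl, v * x, by simp⟩
      · obtain ⟨L, hL, hlen, y, rfl⟩ := ih j (by rw [add_mul, add_mul] at hj; omega)
        refine ⟨v :: L, ?_, by simp [hlen], y, by simp [mul_assoc]⟩
        simp only [List.mem_cons, forall_eq_or_imp]
        exact ⟨⟨i, hi, hv⟩, hL⟩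
    · obtain ⟨L, hL, hlen, y, rfl⟩ := ih j (by rw [add_mul] at hj; omega)
      refine ⟨L, hL, hlen, v * y, ?_⟩
      have : Commute v L.prod := Commute.list_prod_right _ _ fun z hz => by
        obtain ⟨i', -, hz'⟩ := hL z hz
        exact hcomm _ _ v hv z hz'
      rw [← mul_assoc, this.eq, mul_assoc]

/-- The right ideal spanned by the products of `n` iterated commutators of total order at
most `m`. -/
def commutatorSpan (Q E : Set S) (n m : ℕ) : AddSubgroup S :=
  AddSubgroup.closure {z | ∃ x w, CommutatorProd Q E n m x ∧ z = x * w}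

theorem commutatorSpan_mono {Q E : Set S} {n m m' : ℕ} (hm : m ≤ m') :
    commutatorSpan Q E n m ≤ commutatorSpan Q E n m' := by
  refine AddSubgroup.closure_mono ?_
  rintro _ ⟨x, w, hx, rfl⟩
  exact ⟨x, w, hx.mono hm, rfl⟩

theorem mul_mem_commutatorSpan_of_mem {Q E : Set S} {n m : ℕ} {p z : S} (hp : p ∈ Q)
    (hz : z ∈ commutatorSpan Q E n m) : p * z ∈ commutatorSpan Q E (n + 1) m := by
  induction hz using AddSubgroup.closure_induction with
  | mem z hz =>
    obtain ⟨x, w, hx, rfl⟩ := hz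
    refine AddSubgroup.subset_closure ⟨p * x, w, ?_, by rw [mul_assoc]⟩
    exact CommutatorProd.cons (i := 0) hp hx
  | zero => simp
  | add y z _ _ hy hz => rw [mul_add]; exact add_mem hy hz
  | neg y _ hy => rw [mul_neg]; exact neg_mem hy

/-- Since tx = xt + [t,x], and [t,·] obeys the Leibniz rule, moving one letter to the right costs at
most one unit of commutator order. -/
theorem letter_mul_mem_commutatorSpan {Q E : Set S} {n m : ℕ} {t z : S} (ht : t ∈ E)
    (hz : z ∈ commutatorSpan Q E n m) : t * z ∈ commutatorSpan Q E n (m + 1) := by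
  induction hz using AddSubgroup.closure_induction with
  | mem z hz =>
    obtain ⟨x, w, hx, rfl⟩ := hz
    rw [show t * (x * w) = x * (t * w) + (t * x - x * t) * w by noncomm_ring]
    refine add_mem (AddSubgroup.subset_closure ⟨x, t * w, hx.mono (Nat.le_succ m), rfl⟩) ?_
    have h := hx.commutator_mem ht
    generalize t * x - x * t = c at h
    induction h using AddSubgroup.closure_induction with
    | mem y hy => exact AddSubgroup.subset_closure ⟨y, w, hy, rfl⟩
    | zero => simp
    | add y z _ _ hy hz => rw [add_mul]; exact add_mem hy hz
    | neg y _ hy => rw [neg_mul]; exact neg_mem hy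
  | zero => simp
  | add y z _ _ hy hz => rw [mul_add]; exact add_mem hy hz
  | neg y _ hy => rw [mul_neg]; exact neg_mem hy

theorem word_mul_mem_commutatorSpan {Q E : Set S} {n m : ℕ} {z : S} (l : List S)
    (hl : ∀ t ∈ l, t ∈ E) (hz : z ∈ commutatorSpan Q E n m) :
    l.prod * z ∈ commutatorSpan Q E n (m + l.length) := by
  induction l with
  | nil => simpa using hz
  | cons t l ih =>
    rw [List.prod_cons, mul_assoc]
    exact letter_mul_mem_commutatorSpan (hl t (by simp)) (ih fun s hs => hl s (by simp [hs]))

/-- The sums of products of an element of `Q` with a word of length at most `c` in `E`. -/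
def boundedWordSpan (Q E : Set S) (c : ℕ) : AddSubgroup S :=
  AddSubgroup.closure {z | ∃ p ∈ Q, ∃ l : List S, (∀ t ∈ l, t ∈ E) ∧ l.length ≤ c ∧ z = p * l.prod}

theorem boundedWordSpan_mono {Q Q' E E' : Set S} {c c' : ℕ} (hQ : Q ⊆ Q') (hE : E ⊆ E')
    (hc : c ≤ c') : boundedWordSpan Q E c ≤ boundedWordSpan Q' E' c' := by
  refine AddSubgroup.closure_mono ?_
  rintro _ ⟨p, hp, l, hl, hlen, rfl⟩
  exact ⟨p, hQ hp, l, fun t ht => hE (hl t ht), hlen.trans hc, rfl⟩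

theorem boundedWordSpan_mul_mem {Q E : Set S} {c n m : ℕ} {g z : S}
    (hg : g ∈ boundedWordSpan Q E c) (hz : z ∈ commutatorSpan Q E n m) :
    g * z ∈ commutatorSpan Q E (n + 1) (m + c) := by
  induction hg using AddSubgroup.closure_induction with
  | mem g hg =>
    obtain ⟨p, hp, l, hl, hlen, rfl⟩ := hg
    rw [mul_assoc]
    exact mul_mem_commutatorSpan_of_mem hp
      (commutatorSpan_mono (by omega) (word_mul_mem_commutatorSpan l hl hz))
  | zero => simp
  | add y z _ _ hy hz => rw [add_mul]; exact add_mem hy hz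
  | neg y _ hy => rw [neg_mul]; exact neg_mem hy

/-- Each factor contributes one element of `Q` and at most `c` letters, so it raises the total order
by at most `c`. -/
theorem list_prod_mem_commutatorSpan {Q E : Set S} {c : ℕ} (L : List S)
    (hL : ∀ x ∈ L, x ∈ boundedWordSpan Q E c) :
    L.prod ∈ commutatorSpan Q E L.length (L.length * c) := by
  induction L with
  | nil => exact AddSubgroup.subset_closure ⟨1, 1, .one _, by simp⟩
  | cons x L ih =>
    rw [List.prod_cons, List.length_cons, add_mul, one_mul]
    exact boundedWordSpan_mul_mem (hL x (by simp)) (ih fun y hy => hL y (by simp [hy]))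

theorem exists_boundedWordSpan {N T : Set S} {x : S}
    (hx : x ∈ AddSubgroup.closure {z | ∃ p ∈ N, ∃ l : List S, (∀ t ∈ l, t ∈ T) ∧ z = p * l.prod}) :
    ∃ Q E : Set S, Q.Finite ∧ E.Finite ∧ Q ⊆ N ∧ E ⊆ T ∧ ∃ c, x ∈ boundedWordSpan Q E c := by
  induction hx using AddSubgroup.closure_induction with
  | mem x hx =>
    obtain ⟨p, hp, l, hl, rfl⟩ := hx
    exact ⟨{p}, {t | t ∈ l}, Set.finite_singleton p, l.finite_toSet, by simpa using hp, hl,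
      l.length, AddSubgroup.subset_closure ⟨p, rfl, l, fun _ h => h, le_rfl, rfl⟩⟩
  | zero => exact ⟨∅, ∅, Set.finite_empty, Set.finite_empty, by simp, by simp, 0, zero_mem _⟩
  | add x y _ _ hx hy =>
    obtain ⟨Q, E, hQ, hE, hQN, hET, c, hx⟩ := hx
    obtain ⟨Q', E', hQ', hE', hQN', hET', c', hy⟩ := hy
    exact ⟨Q ∪ Q', E ∪ E', hQ.union hQ', hE.union hE', Set.union_subset hQN hQN',
      Set.union_subset hET hET', max c c', add_mem
        (boundedWordSpan_mono Set.subset_union_left Set.subset_union_left (le_max_left _ _) hx)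
        (boundedWordSpan_mono Set.subset_union_right Set.subset_union_right (le_max_right _ _) hy)⟩
  | neg x _ hx =>
    obtain ⟨Q, E, hQ, hE, hQN, hET, c, hx⟩ := hx
    exact ⟨Q, E, hQ, hE, hQN, hET, c, neg_mem hx⟩

/-- Let `N` be a set of commuting nilpotent elements that is stable under commutators with `T`.
Then the sums of elements `p t₁ ⋯ tₙ` with `p ∈ N` and `tᵢ ∈ T` form a locally nilpotent set. -/
theorem exists_list_prod_eq_zero_of_commutator_mem {N T : Set S}
    (hcomm : ∀ x ∈ N, ∀ y ∈ N, x * y = y * x) (hnil : ∀ x ∈ N, IsNilpotent x)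
    (hT : ∀ t ∈ T, ∀ v ∈ N, t * v - v * t ∈ N) {F : Set S} (hF : F.Finite)
    (hFI : ∀ x ∈ F, x ∈ AddSubgroup.closure
      {z | ∃ p ∈ N, ∃ l : List S, (∀ t ∈ l, t ∈ T) ∧ z = p * l.prod}) :
    ∃ e : ℕ, ∀ L : List S, (∀ x ∈ L, x ∈ F) → L.length = e → L.prod = 0 := by
  obtain ⟨Q, E, hQ, hE, hQN, hET, c, hFc⟩ : ∃ Q E : Set S, Q.Finite ∧ E.Finite ∧ Q ⊆ N ∧ E ⊆ T ∧
      ∃ c, ∀ x ∈ F, x ∈ boundedWordSpan Q E c := by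
    induction F, hF using Set.Finite.induction_on with
    | empty => exact ⟨∅, ∅, Set.finite_empty, Set.finite_empty, by simp, by simp, 0, by simp⟩
    | @insert u F _ _ ih =>
      obtain ⟨Q, E, hQ, hE, hQN, hET, c, hx⟩ := ih fun x hx => hFI x (.inr hx)
      obtain ⟨Q', E', hQ', hE', hQN', hET', c', hy⟩ := exists_boundedWordSpan (hFI u (.inl rfl))
      refine ⟨Q ∪ Q', E ∪ E', hQ.union hQ', hE.union hE', Set.union_subset hQN hQN',
        Set.union_subset hET hET', max c c', ?_⟩
      rintro x (rfl | h)
      · exact boundedWordSpan_mono Set.subset_union_right Set.subset_union_right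
          (le_max_right _ _) hy
      · exact boundedWordSpan_mono Set.subset_union_left Set.subset_union_left
          (le_max_left _ _) (hx x h)
  have hVN : ∀ i, iteratedCommutators Q E i ⊆ N :=
    iteratedCommutators_subset hQN fun t ht => hT t (hET ht)
  obtain ⟨e, he⟩ := exists_list_prod_eq_zero_of_finite
    (U := ⋃ i ∈ Set.Iio (c + 1), iteratedCommutators Q E i)
    ((Set.finite_Iio _).biUnion fun i _ => iteratedCommutators_finite hQ hE i)
    (fun x hx y hy => by
      simp only [Set.mem_iUnion] at hx hy
      obtain ⟨i, _, hx⟩ := hx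
      obtain ⟨j, _, hy⟩ := hy
      exact hcomm x (hVN i hx) y (hVN j hy))
    (fun x hx => by
      simp only [Set.mem_iUnion] at hx
      obtain ⟨i, _, hx⟩ := hx
      exact hnil x (hVN i hx))
  -- The total order is at most e(c+1)c, so at most ec of the e(c+1) commutators have order above c.
  -- At least e are left in the finite set to which `he` applies.
  refine ⟨e * (c + 1), fun L hL hlen => ?_⟩
  have hmem := list_prod_mem_commutatorSpan L fun x hx => hFc x (hL x hx)
  rw [hlen] at hmem
  generalize L.prod = z at hmem
  induction hmem using AddSubgroup.closure_induction with
  | mem z hz =>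
    obtain ⟨x, w, hx, rfl⟩ := hz
    obtain ⟨L', hL', hlen', y, rfl⟩ := hx.exists_factor (k := c + 1)
      (fun i j x hx y hy => hcomm x (hVN i hx) y (hVN j hy)) c.succ_pos e (by nlinarith)
    rw [he L' (fun x hx => by
      obtain ⟨i, hi, hxi⟩ := hL' x hx
      exact Set.mem_biUnion hi hxi) hlen', zero_mul, zero_mul]
  | zero => rfl
  | add y z _ _ hy hz => rw [hy, hz, add_zero]
  | neg y _ hy => rw [hy, neg_zero]

/-- If all products of `n` elements of `F` vanish, so do all products of `n` elements of the
subring generated by `F`. -/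
theorem list_prod_eq_zero_of_mem_closure {F : Set S} {n : ℕ}
    (h : ∀ L : List S, (∀ x ∈ L, x ∈ F) → L.length = n → L.prod = 0) (L : List S)
    (hL : ∀ x ∈ L, x ∈ NonUnitalSubring.closure F) (hlen : L.length = n) : L.prod = 0 := by
  -- Vanishing is required for all words of length at least k, not exactly k, because s may be a
  -- product of several generators.
  have step : ∀ s ∈ NonUnitalSubring.closure F, ∀ k y,
      (∀ L : List S, (∀ x ∈ L, x ∈ F) → k + 1 ≤ L.length → L.prod * y = 0) →
      ∀ L : List S, (∀ x ∈ L, x ∈ F) → k ≤ L.length → L.prod * (s * y) = 0 := by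
    intro s hs
    induction hs using NonUnitalSubring.closure_induction with
    | mem s hs =>
      intro k y hy L hL hk
      have := hy (L ++ [s]) (by
        simp only [List.mem_append, List.mem_singleton]
        rintro x (hx | rfl)
        exacts [hL x hx, hs]) (by simpa using hk)
      simpa [mul_assoc] using this
    | zero => simp
    | add s s' _ _ hs hs' =>
      intro k y hy L hL hk
      rw [add_mul, mul_add, hs k y hy L hL hk, hs' k y hy L hL hk, add_zero]
    | neg s _ hs =>
      intro k y hy L hL hk
      rw [neg_mul, mul_neg, hs k y hy L hL hk, neg_zero]
    | mul s s' _ _ hs hs' =>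
      intro k y hy L hL hk
      rw [mul_assoc]
      exact hs k (s' * y) (fun L hL hk' => hs' k y hy L hL (by omega)) L hL hk
  have main : ∀ L : List S, (∀ x ∈ L, x ∈ NonUnitalSubring.closure F) → ∀ k,
      k + L.length = n → ∀ L' : List S, (∀ x ∈ L', x ∈ F) → k ≤ L'.length →
      L'.prod * L.prod = 0 := by
    intro L
    induction L with
    | nil =>
      intro _ k hk L' hL' hlen'
      simp only [List.length_nil, add_zero] at hk
      subst hk
      rw [← List.take_append_drop k L', List.prod_append,
        h (L'.take k) (fun x hx => hL' x (List.mem_of_mem_take hx)) (by simp; omega),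
        zero_mul, zero_mul]
    | cons s L ih =>
      intro hL k hk
      rw [List.prod_cons]
      exact step s (hL s (by simp)) k L.prod
        (ih (fun x hx => hL x (by simp [hx])) (k + 1) (by rw [← hk, List.length_cons]; omega))
  simpa using main L hL 0 (by omega) [] (by simp) (Nat.zero_le _)

/-- A derivation of a ring without additive torsion maps nilpotent elements to nilpotent
elements, provided that each of the first two derivatives commutes with the previous one. -/
theorem isNilpotent_of_leibniz [IsAddTorsionFree S] (δ : S →+ S)
    (hδ : ∀ x y, δ (x * y) = δ x * y + x * δ y) {p : S} (hpq : Commute p (δ p))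
    (hqr : Commute (δ p) (δ (δ p))) (hp : IsNilpotent p) :
    IsNilpotent (δ p) := by
  have hδ1 : δ 1 = 0 := by simpa using hδ 1 1
  have hpow : ∀ x, Commute x (δ x) → ∀ m : ℕ, δ (x ^ (m + 1)) = (m + 1) • (x ^ m * δ x) := by
    intro x hx m
    induction m with
    | zero => simp
    | succ m ih =>
      rw [pow_succ, hδ, ih, smul_mul_assoc, mul_assoc, ← hx.eq, ← mul_assoc, ← pow_succ,
        ← succ_nsmul]
  have main : ∀ m j : ℕ, p ^ m * δ p ^ (j + 1) = 0 → IsNilpotent (δ p) := by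
    intro m
    induction m with
    | zero => exact fun j h => ⟨j + 1, by simpa using h⟩
    | succ m ih =>
      intro j h
      -- Put q = δp. After multiplication by q, the term containing δq has the factor p^(m+1)
      -- q^(j+1) = 0. What is left is (m+1) p^m q^(j+3) = 0, with one power of p fewer.
      have h2 := congrArg (fun x => δ x * δ p) h
      simp only [hδ, hpow p hpq, hpow _ hqr, map_zero, zero_mul] at h2
      refine ih (j + 2) ?_
      have h3 : p ^ (m + 1) * (j + 1) • (δ p ^ j * δ (δ p)) * δ p = 0 := by
        rw [mul_smul_comm, smul_mul_assoc, mul_assoc, mul_assoc, ← hqr.eq, ← mul_assoc (δ p ^ j),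
          ← pow_succ, ← mul_assoc, h, zero_mul, smul_zero]
      rw [add_mul, h3, add_zero, smul_mul_assoc, smul_mul_assoc] at h2
      have h4 := (smul_eq_zero_iff_right (Nat.succ_ne_zero m)).1 h2
      rwa [mul_assoc, mul_assoc, ← pow_succ, ← pow_succ'] at h4
  obtain ⟨n, hn⟩ := hp
  exact main n 0 (by rw [hn, zero_mul])

end UnitalRing

/-! ### Words and the prime radical in non-unital rings -/

section Words

variable {R : Type*} [NonUnitalRing R]

theorem mulWord_cons (r t : R) (l : List R) : mulWord r (t :: l) = mulWord (r * t) l := rfl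

theorem mulWord_concat (r t : R) (l : List R) : mulWord r (l ++ [t]) = mulWord r l * t := by
  simp [mulWord]

theorem mulWord_add (r s : R) (l : List R) : mulWord (r + s) l = mulWord r l + mulWord s l := by
  induction l generalizing r s with
  | nil => rfl
  | cons t l ih => rw [mulWord_cons, add_mul, ih]; rfl

theorem mul_mulWord (x r : R) (l : List R) : x * mulWord r l = mulWord (x * r) l := by
  induction l generalizing r with
  | nil => rfl
  | cons t l ih => rw [mulWord_cons, ih, mulWord_cons, mul_assoc]

variable {K : Type*} [Field K] [Module K R] [IsScalarTower K R R]

theorem smul_mulWord (k : K) (r : R) (l : List R) : k • mulWord r l = mulWord (k • r) l := by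
  induction l generalizing r with
  | nil => rfl
  | cons t l ih => rw [mulWord_cons, ih, mulWord_cons, smul_mul_assoc]

theorem inr_mulWord [SMulCommClass K R R] (r : R) (l : List R) :
    ((mulWord r l : R) : Unitization K R) =
      (r : Unitization K R) * (l.map ((↑) : R → Unitization K R)).prod := by
  induction l generalizing r with
  | nil => simp [mulWord]
  | cons t l ih => rw [mulWord_cons, ih, Unitization.inr_mul, List.map_cons, List.prod_cons, mul_assoc]

theorem mulWord_mem_skewStar {P T : Set R} {r : R} (hr : r ∈ P) {l : List R}
    (hl : ∀ t ∈ l, t ∈ T) : mulWord r l ∈ skewStar P T :=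
  AddSubgroup.subset_closure ⟨r, hr, l, hl, rfl⟩

theorem mem_skewStar {P T : Set R} {r : R} (hr : r ∈ P) : r ∈ skewStar P T :=
  mulWord_mem_skewStar hr (l := []) (by simp)

theorem skewStar_mul_mem {P T : Set R} {x t : R} (hx : x ∈ skewStar P T) (ht : t ∈ T) :
    x * t ∈ skewStar P T := by
  induction hx using AddSubgroup.closure_induction with
  | mem x hx =>
    obtain ⟨r, hr, l, hl, rfl⟩ := hx
    rw [← mulWord_concat]
    refine mulWord_mem_skewStar hr ?_
    simp only [List.mem_append, List.mem_singleton]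
    rintro s (hs | rfl)
    exacts [hl s hs, ht]
  | zero => simp
  | add y z _ _ hy hz => rw [add_mul]; exact add_mem hy hz
  | neg y _ hy => rw [neg_mul]; exact neg_mem hy

theorem smul_mem_skewStar {P T : Set R} (hP : ∀ (k : K), ∀ p ∈ P, k • p ∈ P) (k : K) {x : R}
    (hx : x ∈ skewStar P T) : k • x ∈ skewStar P T := by
  induction hx using AddSubgroup.closure_induction with
  | mem x hx =>
    obtain ⟨r, hr, l, hl, rfl⟩ := hx
    rw [smul_mulWord]
    exact mulWord_mem_skewStar (hP k r hr) hl
  | zero => simp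
  | add y z _ _ hy hz => rw [smul_add]; exact add_mem hy hz
  | neg y _ hy => rw [smul_neg]; exact neg_mem hy

variable [SMulCommClass K R R]

/-- Induction on words for an algebra that is generated by `T`. -/
theorem word_induction {T : Set R} (hT : NonUnitalAlgebra.adjoin K T = ⊤) {q : R → Prop}
    (mem : ∀ t ∈ T, q t) (zero : q 0) (add : ∀ x y, q x → q y → q (x + y))
    (smul : ∀ (k : K) x, q x → q (k • x)) (mul : ∀ t ∈ T, ∀ x, q x → q (t * x)) (x : R) : q x := by
  have hx : x ∈ NonUnitalAlgebra.adjoin K T := hT ▸ NonUnitalAlgebra.mem_top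
  -- The second clause is what makes the induction pass through products of two arbitrary elements.
  suffices q x ∧ ∀ y, q y → q (x * y) from this.1
  induction hx using NonUnitalAlgebra.adjoin_induction with
  | mem x hx => exact ⟨mem x hx, mul x hx⟩
  | add x y _ _ hx hy =>
    exact ⟨add _ _ hx.1 hy.1, fun z hz => by rw [add_mul]; exact add _ _ (hx.2 z hz) (hy.2 z hz)⟩
  | zero => exact ⟨zero, fun z _ => by rwa [zero_mul]⟩
  | mul x y _ _ hx hy =>
    exact ⟨hx.2 y hy.1, fun z hz => by rw [mul_assoc]; exact hx.2 _ (hy.2 z hz)⟩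
  | smul k x _ hx =>
    exact ⟨smul k x hx.1, fun z hz => by rw [smul_mul_assoc]; exact smul k _ (hx.2 z hz)⟩

theorem skewStar_mul_mem_of_adjoin {P T : Set R} (hT : NonUnitalAlgebra.adjoin K T = ⊤)
    (hP : ∀ (k : K), ∀ p ∈ P, k • p ∈ P) {x : R} (hx : x ∈ skewStar P T) (y : R) :
    x * y ∈ skewStar P T := by
  induction y using word_induction hT generalizing x with
  | mem t ht => exact skewStar_mul_mem hx ht
  | zero => simp
  | add y z hy hz => rw [mul_add]; exact add_mem (hy hx) (hz hx)
  | smul k y hy => rw [mul_smul_comm]; exact smul_mem_skewStar hP k (hy hx)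
  | mul t ht y hy => rw [← mul_assoc]; exact hy (skewStar_mul_mem hx ht)

end Words

/-! ### The prime radical of a commutative ring without identity. -/

section PrimeRadical

theorem mem_or_mem_of_isPrimeTwoSided {A : Type*} [NonUnitalCommRing A] {Q : TwoSidedIdeal A}
    (hQ : IsPrimeTwoSided Q) {a b : A} (hab : a * b ∈ Q) : a ∈ Q ∨ b ∈ Q := by
  have key : ∀ x ∈ TwoSidedIdeal.span {a}, ∀ y ∈ TwoSidedIdeal.span {b}, x * y ∈ Q := by
    intro x hx
    induction hx using TwoSidedIdeal.span_induction with
    | mem x hx =>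
      obtain rfl : x = a := hx
      intro y hy
      induction hy using TwoSidedIdeal.span_induction with
      | mem y hy =>
        obtain rfl : y = b := hy
        exact hab
      | zero => rw [mul_zero]; exact Q.zero_mem
      | add y z _ _ hy hz => rw [mul_add]; exact Q.add_mem hy hz
      | neg y _ hy => rw [mul_neg]; exact Q.neg_mem hy
      | left_absorb c y _ hy => rw [mul_left_comm]; exact Q.mul_mem_left _ _ hy
      | right_absorb c y _ hy => rw [← mul_assoc]; exact Q.mul_mem_right _ _ hy
    | zero => intro y _; rw [zero_mul]; exact Q.zero_mem
    | add x z _ _ hx hz => intro y hy; rw [add_mul]; exact Q.add_mem (hx y hy) (hz y hy)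
    | neg x _ hx => intro y hy; rw [neg_mul]; exact Q.neg_mem (hx y hy)
    | left_absorb c x _ hx =>
      intro y hy; rw [mul_assoc]; exact Q.mul_mem_left _ _ (hx y hy)
    | right_absorb c x _ hx =>
      intro y hy; rw [mul_right_comm]; exact Q.mul_mem_right _ _ (hx y hy)
  rcases hQ.2 _ _ key with h | h
  · exact .inl (h (TwoSidedIdeal.subset_span rfl))
  · exact .inr (h (TwoSidedIdeal.subset_span rfl))

/-- The prime radical of a commutative ring consists of its nilpotent elements. -/
theorem mem_primeRadical_iff (K : Type*) {A : Type*} [Field K] [NonUnitalCommRing A] [Module K A]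
    [IsScalarTower K A A] [SMulCommClass K A A] {a : A} :
    a ∈ primeRadical A ↔ IsNilpotent (a : Unitization K A) := by
  rw [primeRadical, TwoSidedIdeal.mem_sInf]
  constructor
  · intro h
    rw [nilpotent_iff_mem_prime]
    intro q hq
    by_contra ha
    have hmem : ∀ x : A, x ∈ TwoSidedIdeal.comap (Unitization.inrNonUnitalAlgHom K A) q.toTwoSided ↔
        (x : Unitization K A) ∈ q := fun x => by
      rw [TwoSidedIdeal.mem_comap, Ideal.mem_toTwoSided]; rfl
    refine ha ((hmem a).1 (h _ ⟨fun htop => ha ((hmem a).1 (htop ▸ trivial)), fun I J hIJ => ?_⟩))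
    by_contra! hne
    obtain ⟨x, hxI, hx⟩ := SetLike.not_le_iff_exists.1 hne.1
    obtain ⟨y, hyJ, hy⟩ := SetLike.not_le_iff_exists.1 hne.2
    rw [hmem] at hx hy
    have := (hmem _).1 (hIJ x hxI y hyJ)
    rw [Unitization.inr_mul] at this
    exact (hq.mem_or_mem this).elim hx hy
  · rintro ⟨n, hn⟩ Q hQ
    -- The extra factor b keeps every product inside A, where primeness applies, although a^0 exists
    -- only in the unitization.
    have main : ∀ n, ∀ b : A, (a : Unitization K A) ^ n * (b : Unitization K A) = 0 →
        a ∈ Q ∨ b ∈ Q := by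
      intro n
      induction n with
      | zero =>
        intro b hb
        rw [pow_zero, one_mul, ← Unitization.inr_zero K] at hb
        rw [Unitization.inr_injective hb]
        exact .inr Q.zero_mem
      | succ n ih =>
        intro b hb
        rw [pow_succ, mul_assoc, ← Unitization.inr_mul] at hb
        exact (ih _ hb).elim .inl (mem_or_mem_of_isPrimeTwoSided hQ)
    exact (main n a (by rw [hn, zero_mul])).elim id id

end PrimeRadical

/-! ### Passage to the Jacobson radical of the unitization. -/

section JacobsonRadical

variable {K R : Type*} [Field K] [NonUnitalRing R] [Module K R] [IsScalarTower K R R]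
  [SMulCommClass K R R]

/-- Only this inclusion is needed; the target has the advantage of being closed under scalars. -/
theorem inr_mem_jacobson_of_mem_jacobsonRadical {x : R} (hx : x ∈ jacobsonRadical R) :
    (x : Unitization K R) ∈ Ideal.jacobson (⊥ : Ideal (Unitization K R)) := by
  have hle : jacobsonRadical R ≤ TwoSidedIdeal.comap (Unitization.inrNonUnitalAlgHom K R)
      (Ideal.jacobson (⊥ : Ideal (Unitization K R))).toTwoSided := by
    refine sSup_le fun I hI x hx => ?_
    rw [TwoSidedIdeal.mem_comap, Ideal.mem_toTwoSided]
    refine Ideal.mem_jacobson_iff.2 fun y => ?_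
    -- The ideal I need not be a K-subspace, so w = yx may lie outside it, but w² lies in I. Thus 1
    -- - w² is invertible, and (1 - w²)⁻¹(1 - w) is a left inverse of 1 + w.
    obtain ⟨w, hw, hwI⟩ : ∃ w : R, y * (x : Unitization K R) = w ∧ w * w ∈ I := by
      induction y using Unitization.ind with
      | inl_add_inr k r =>
        refine ⟨k • x + r * x, by simp [add_mul, Unitization.inl_mul_inr], ?_⟩
        generalize hw : k • x + r * x = w
        have : w * w = (k • w + w * r) * x := by
          rw [add_mul, smul_mul_assoc, mul_assoc, ← mul_smul_comm, ← mul_add, hw]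
        rw [this]
        exact I.mul_mem_left _ _ hx
    obtain ⟨u, hu⟩ := (isQuasiregular_iff_isUnit' K).1 (hI _ (I.neg_mem hwI))
    refine ⟨↑u⁻¹ * (1 - (w : Unitization K R)), ?_⟩
    have huw : (↑u⁻¹ : Unitization K R) * (1 + ((-(w * w) : R) : Unitization K R)) = 1 := by
      rw [← hu, Units.inv_mul]
    rw [Ideal.mem_bot]
    change ↑u⁻¹ * (1 - (w : Unitization K R)) * y * (x : Unitization K R) +
      ↑u⁻¹ * (1 - (w : Unitization K R)) - 1 = 0
    rw [mul_assoc, hw, sub_eq_zero]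
    refine Eq.trans ?_ huw
    rw [Unitization.inr_neg, Unitization.inr_mul]
    noncomm_ring
  have := hle hx
  rwa [TwoSidedIdeal.mem_comap, Ideal.mem_toTwoSided] at this

/-- A left inverse of 1 + x has scalar part 1, so it is 1 + y with y in R. -/
theorem exists_add_add_mul_eq_zero {x : R}
    (hx : (x : Unitization K R) ∈ Ideal.jacobson (⊥ : Ideal (Unitization K R))) :
    ∃ y : R, x + y + y * x = 0 := by
  obtain ⟨z, hz⟩ := Ideal.mem_jacobson_iff.1 hx 1
  rw [Ideal.mem_bot, mul_one, sub_eq_zero] at hz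
  have h1 := congrArg (fun x => x.toProd.1) hz
  have h2 := congrArg (fun x => x.toProd.2) hz
  simp only [Unitization.fst_add, Unitization.fst_mul, Unitization.fst_inr, mul_zero, zero_add,
    Unitization.fst_one] at h1
  simp only [Unitization.snd_add, Unitization.snd_mul, Unitization.fst_inr, Unitization.snd_inr,
    Unitization.snd_one, h1, one_smul, zero_smul, add_zero] at h2
  refine ⟨z.toProd.2, ?_⟩
  rw [← h2]
  abel

end JacobsonRadical

/-! ### Locally nilpotent derivations -/

section Derivation

variable {K R : Type*} [Field K] [NonUnitalRing R] [Module K R] (d : R →ₗ[K] R)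

theorem pow_apply_eq_zero_of_le {x : R} {m n : ℕ} (h : m ≤ n) (hx : (d ^ m) x = 0) :
    (d ^ n) x = 0 := by
  obtain ⟨k, rfl⟩ := Nat.exists_eq_add_of_le h
  rw [add_comm, pow_add, Module.End.mul_apply, hx, map_zero]

variable {d}

theorem pow_apply_mul
    (hd : ∀ x y, d (x * y) = d x * y + x * d y)
    (n : ℕ) (x y : R) : (d ^ n) (x * y) =
    ∑ ij ∈ Finset.HasAntidiagonal.antidiagonal n, n.choose ij.1 • ((d ^ ij.1) x * (d ^ ij.2) y) := by
  induction n with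
  | zero => simp
  | succ n ih =>
    rw [Finset.sum_antidiagonal_choose_succ_nsmul (fun i j => (d ^ i) x * (d ^ j) y), pow_succ',
      Module.End.mul_apply, ih, map_sum, ← Finset.sum_add_distrib]
    refine Finset.sum_congr rfl fun ij hij => ?_
    have hsymm : n.choose ij.2 = n.choose ij.1 :=
      Nat.choose_symm_of_eq_add (by rw [← Finset.HasAntidiagonal.mem_antidiagonal.1 hij, add_comm])
    rw [map_nsmul, hd, nsmul_add, add_comm, hsymm, pow_succ', pow_succ', Module.End.mul_apply,
      Module.End.mul_apply]

/-- The leading term of a product. -/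
theorem pow_apply_mul_of_pow_eq_zero
    (hd : ∀ x y, d (x * y) = d x * y + x * d y)
    {x y : R} {m n : ℕ} (hx : (d ^ (m + 1)) x = 0)
    (hy : (d ^ (n + 1)) y = 0) :
    (d ^ (m + n)) (x * y) = (m + n).choose m • ((d ^ m) x * (d ^ n) y) := by
  rw [pow_apply_mul hd, Finset.sum_eq_single (m, n)]
  · rintro ⟨i, j⟩ hij hne
    rw [Finset.HasAntidiagonal.mem_antidiagonal] at hij
    dsimp only at hij ⊢
    rcases lt_trichotomy i m with h | rfl | h
    · rw [pow_apply_eq_zero_of_le d (show n + 1 ≤ j by omega) hy, mul_zero, smul_zero]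
    · exact absurd (by rw [show j = n by omega]) hne
    · rw [pow_apply_eq_zero_of_le d (show m + 1 ≤ i by omega) hx, zero_mul, smul_zero]
  · intro h
    exact absurd ((Finset.HasAntidiagonal.mem_antidiagonal (a := (m, n))).2 rfl) h

theorem pow_apply_constant_mul
    (hd : ∀ x y, d (x * y) = d x * y + x * d y)
    {a : R} (ha : d a = 0) (n : ℕ) (x : R) :
    (d ^ n) (a * x) = a * (d ^ n) x := by
  induction n with
  | zero => rfl
  | succ n ih =>
    rw [pow_succ', Module.End.mul_apply, ih, hd, ha, zero_mul, zero_add, Module.End.mul_apply]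

theorem commutator_mem_constants
    (hd : ∀ x y, d (x * y) = d x * y + x * d y)
    (hcomm : ∀ x y, d x = 0 → d y = 0 → x * y = y * x)
    {t a : R} (ht : d (d t) = 0) (ha : d a = 0) :
    d (t * a - a * t) = 0 := by
  rw [map_sub, hd, hd, ha, mul_zero, zero_mul, add_zero, zero_add, hcomm _ _ ht ha, sub_self]

/-- Commutators with elements of `ker d²` do not raise the degree. -/
theorem pow_apply_commutator
    (hd : ∀ x y, d (x * y) = d x * y + x * d y)
    (hcomm : ∀ x y, d x = 0 → d y = 0 → x * y = y * x)
    {t r : R} (ht : d (d t) = 0) {n : ℕ} (hr : (d ^ (n + 1)) r = 0) :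
    (d ^ (n + 1)) (t * r - r * t) = 0 := by
  have ht' : (d ^ (1 + 1)) t = 0 := ht
  have hr' : d ((d ^ n) r) = 0 := by rwa [pow_succ', Module.End.mul_apply] at hr
  -- Both tr and rt have leading term n + 1 times the product of dt and d^n(r), and these two
  -- constants commute.
  rw [map_sub, pow_apply_mul_of_pow_eq_zero hd hr ht', add_comm n 1,
    pow_apply_mul_of_pow_eq_zero hd ht' hr, pow_one, hcomm _ _ ht hr', ← Nat.choose_symm_add,
    sub_self]

variable [IsScalarTower K R R] [SMulCommClass K R R] [CharZero K]

/-- If `r` of degree `n ≥ 1` has leading coefficient `p` and `q r + z + z r = 0` for a constant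
`q`, then some `pʲ q` vanishes. -/
theorem exists_pow_mul_eq_zero
    (hd : ∀ x y, d (x * y) = d x * y + x * d y)
    (hcomm : ∀ x y, d x = 0 → d y = 0 → x * y = y * x)
    {r : R} {n : ℕ} (hn : 1 ≤ n) (hr : (d ^ (n + 1)) r = 0) (m : ℕ)
    {q z : R} (hq : d q = 0) (hz : (d ^ (m + 1)) z = 0) (h : q * r + z + z * r = 0) :
    ∃ j : ℕ, (((d ^ n) r : R) : Unitization K R) ^ j * (q : Unitization K R) = 0 := by
  have hp : d ((d ^ n) r) = 0 := by rwa [pow_succ', Module.End.mul_apply] at hr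
  induction m generalizing q z with
  | zero =>
    have hz' : d z = 0 := by simpa using hz
    -- Now z is constant and n ≥ 1, so comparing top terms gives pz = -pq. Substituting this in p
    -- times the equation leaves pq = 0.
    have h1 := congrArg (d ^ n) h
    rw [map_add, map_add, pow_apply_constant_mul hd hq, pow_apply_constant_mul hd hz',
      pow_apply_eq_zero_of_le d hn (show (d ^ 1) z = 0 by simpa using hz'), add_zero, map_zero] at h1
    generalize (d ^ n) r = p at *
    have h2 : p * z = -(p * q) := by
      rw [hcomm _ _ hp hz', hcomm _ _ hp hq]
      exact eq_neg_of_add_eq_zero_right h1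
    have h3 := congrArg (p * ·) h
    simp only [mul_add, ← mul_assoc, h2, mul_zero, neg_mul] at h3
    refine ⟨1, ?_⟩
    rw [pow_one, ← Unitization.inr_mul, ← Unitization.inr_zero K]
    congr 1
    rw [← neg_eq_zero, ← h3]
    abel
  | succ m ih =>
    -- As n ≥ 1, only zr reaches this degree. Hence p annihilates the leading coefficient of z, and
    -- the equation multiplied by p has the same form with pz of smaller degree.
    have h1 := congrArg (d ^ (m + 1 + n)) h
    have hc : d ((d ^ (m + 1)) z) = 0 := by rwa [pow_succ', Module.End.mul_apply] at hz
    rw [map_add, map_add, pow_apply_constant_mul hd hq,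
      pow_apply_eq_zero_of_le d (show n + 1 ≤ m + 1 + n by omega) hr,
      pow_apply_eq_zero_of_le d (show m + 1 + 1 ≤ m + 1 + n by omega) hz,
      pow_apply_mul_of_pow_eq_zero hd hz hr, mul_zero, zero_add, zero_add, map_zero,
      ← Nat.cast_smul_eq_nsmul K, smul_eq_zero, Nat.cast_eq_zero] at h1
    have h2 := h1.resolve_left (Nat.choose_pos (by omega)).ne'
    generalize hpr : (d ^ n) r = p at *
    obtain ⟨j, hj⟩ := ih (q := p * q) (z := p * z) (by rw [hd, hp, hq, zero_mul, mul_zero, add_zero])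
      (by rw [pow_apply_constant_mul hd hp, hcomm _ _ hp hc, h2])
      (by simpa only [mul_add, mul_assoc, mul_zero] using congrArg (p * ·) h)
    exact ⟨j + 1, by rw [pow_succ, mul_assoc, ← Unitization.inr_mul, hj]⟩

/-- The leading coefficient of a quasi-regular element of positive degree is nilpotent. -/
theorem isNilpotent_leadingCoeff
    (hd : ∀ x y, d (x * y) = d x * y + x * d y)
    (hcomm : ∀ x y, d x = 0 → d y = 0 → x * y = y * x)
    (hnil : ∀ r, ∃ n : ℕ, (d ^ n) r = 0) {r y : R}
    (hy : r + y + y * r = 0) {n : ℕ} (hn : 1 ≤ n) (hr : (d ^ (n + 1)) r = 0) :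
    IsNilpotent (((d ^ n) r : R) : Unitization K R) := by
  have hp : d ((d ^ n) r) = 0 := by rwa [pow_succ', Module.End.mul_apply] at hr
  obtain ⟨m, hm⟩ := hnil y
  obtain ⟨j, hj⟩ := exists_pow_mul_eq_zero hd hcomm hn hr m (q := (d ^ n) r) (z := (d ^ n) r * y) hp
    (by rw [pow_apply_constant_mul hd hp, pow_apply_eq_zero_of_le d (Nat.le_succ m) hm, mul_zero])
    (by simpa only [mul_add, mul_assoc, mul_zero] using congrArg ((d ^ n) r * ·) hy)
  exact ⟨j + 1, by rw [pow_succ, hj]⟩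

end Derivation

/-- The nilpotent constants of `d`. -/
def nilConstants {K R : Type*} [Field K] [NonUnitalRing R] [Module K R] [IsScalarTower K R R]
    [SMulCommClass K R R] (d : R →ₗ[K] R) : Set R :=
  {p | d p = 0 ∧ IsNilpotent (p : Unitization K R)}

/-! ### Nilpotent constants and the right ideal they generate. -/

section Main

variable {K R : Type*} [Field K] [NonUnitalRing R] [Module K R]
  [IsScalarTower K R R] [SMulCommClass K R R] {d : R →ₗ[K] R}

theorem smul_mem_nilConstants (k : K) (p : R) (hp : p ∈ nilConstants d) :
    k • p ∈ nilConstants d :=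
  ⟨by rw [map_smul, hp.1, smul_zero], by rw [Unitization.inr_smul]; exact hp.2.smul k⟩

/-- Both sides are described by nilpotency, and the unitization of R^d embeds in that of R. -/
theorem image_primeRadical_eq (hd : ∀ x y, d (x * y) = d x * y + x * d y)
    (hcomm : ∀ x y, d x = 0 → d y = 0 → x * y = y * x) :
    (fun p : constants d hd => (p : R)) '' {p | p ∈ primeRadical (constants d hd)} =
      nilConstants d := by
  let _ : NonUnitalCommRing (constants d hd) :=
    { (inferInstance : NonUnitalRing (constants d hd)) with
      mul_comm := fun x y => Subtype.ext (hcomm _ _ x.2 y.2) }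
  let f : Unitization K (constants d hd) →ₐ[K] Unitization K R := Unitization.lift
    ((Unitization.inrNonUnitalAlgHom K R).comp (NonUnitalSubalgebraClass.subtype (constants d hd)))
  have hf : ∀ a : constants d hd, f (a : Unitization K (constants d hd)) = ((a : R) : Unitization K R) :=
    fun a => by simp [f]
  have hinj : Function.Injective f := by
    rw [injective_iff_map_eq_zero]
    intro x hx
    induction x using Unitization.ind with
    | inl_add_inr k a =>
      have hk : f (Unitization.inl k) = Unitization.inl k := f.commutes k
      rw [map_add, hf, hk] at hx
      have h1 := congrArg (fun x => x.toProd.1) hx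
      have h2 := congrArg (fun x => x.toProd.2) hx
      simp at h1 h2
      simp [h1, h2]
  ext p
  constructor
  · rintro ⟨a, ha, rfl⟩
    refine ⟨a.2, ?_⟩
    have := ((mem_primeRadical_iff K).1 ha).map f
    rwa [hf] at this
  · rintro ⟨hp, hnil⟩
    refine ⟨⟨p, hp⟩, (mem_primeRadical_iff K).2 ?_, rfl⟩
    rw [← IsNilpotent.map_iff hinj, hf]
    exact hnil

variable [CharZero K]

/-- The inner derivation [t,·] preserves the commuting constants, so p, [t,p] and [t,[t,p]] satisfy
the hypotheses of `isNilpotent_of_leibniz`. -/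
theorem commutator_mem_nilConstants
    (hd : ∀ x y, d (x * y) = d x * y + x * d y)
    (hcomm : ∀ x y, d x = 0 → d y = 0 → x * y = y * x)
    {t p : R} (ht : d (d t) = 0) (hp : p ∈ nilConstants d) :
    t * p - p * t ∈ nilConstants d := by
  have h1 := commutator_mem_constants hd hcomm ht hp.1
  have h2 := commutator_mem_constants hd hcomm ht h1
  refine ⟨h1, ?_⟩
  have : IsAddTorsionFree (Unitization K R) := .of_isTorsionFree K _
  let δ : Unitization K R →+ Unitization K R :=
    AddMonoidHom.mulLeft (t : Unitization K R) - AddMonoidHom.mulRight (t : Unitization K R)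
  have hδ : ∀ x : R, δ x = ((t * x - x * t : R) : Unitization K R) := fun x => by
    simp [δ, Unitization.inr_sub]
  have hc : ∀ x y : R, d x = 0 → d y = 0 → Commute (x : Unitization K R) (y : Unitization K R) :=
    fun x y hx hy => by
      rw [Commute, SemiconjBy, ← Unitization.inr_mul, ← Unitization.inr_mul, hcomm x y hx hy]
  have := isNilpotent_of_leibniz δ (fun x y => by simp [δ]; noncomm_ring) (p := (p : Unitization K R))
    (by rw [hδ]; exact hc _ _ hp.1 h1) (by rw [hδ, hδ]; exact hc _ _ h1 h2) hp.2
  rwa [hδ] at this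

/-- Finite subsets of `N⟨T⟩*` are nilpotent, where `N` is the set of nilpotent constants. -/
theorem exists_list_prod_eq_zero_of_skewStar
    (hd : ∀ x y, d (x * y) = d x * y + x * d y)
    (hcomm : ∀ x y, d x = 0 → d y = 0 → x * y = y * x)
    {F : Set (Unitization K R)} (hF : F.Finite)
    (hFI : ∀ x ∈ F, ∃ y ∈ skewStar (nilConstants d) (LinearMap.ker (d ^ 2) : Set R), x = y) :
    ∃ e : ℕ, ∀ L : List (Unitization K R), (∀ x ∈ L, x ∈ F) → L.length = e → L.prod = 0 := by
  refine exists_list_prod_eq_zero_of_commutator_mem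
    (N := (↑) '' nilConstants d) (T := (↑) '' (LinearMap.ker (d ^ 2) : Set R)) ?_ ?_ ?_ hF ?_
  · rintro _ ⟨p, hp, rfl⟩ _ ⟨q, hq, rfl⟩
    rw [← Unitization.inr_mul, ← Unitization.inr_mul, hcomm p q hp.1 hq.1]
  · rintro _ ⟨p, hp, rfl⟩
    exact hp.2
  · rintro _ ⟨t, ht, rfl⟩ _ ⟨p, hp, rfl⟩
    exact ⟨_, commutator_mem_nilConstants hd hcomm ht hp, by
      rw [Unitization.inr_sub, Unitization.inr_mul, Unitization.inr_mul]⟩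
  · intro x hx
    obtain ⟨y, hy, rfl⟩ := hFI x hx
    clear hx
    induction hy using AddSubgroup.closure_induction with
    | mem y hy =>
      obtain ⟨p, hp, l, hl, rfl⟩ := hy
      refine AddSubgroup.subset_closure ⟨p, ⟨p, hp, rfl⟩, l.map (↑), ?_, inr_mulWord p l⟩
      intro s hs
      obtain ⟨t, ht, rfl⟩ := List.mem_map.1 hs
      exact ⟨t, hl t ht, rfl⟩
    | zero => rw [Unitization.inr_zero]; exact zero_mem _
    | add y z _ _ hy hz => rw [Unitization.inr_add]; exact add_mem hy hz
    | neg y _ hy => rw [Unitization.inr_neg]; exact neg_mem hy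

end Main

/-! ### The Jacobson radical and leading coefficients. -/

section Main

variable {K R : Type*} [Field K] [NonUnitalRing R] [Module K R]
  [IsScalarTower K R R] [SMulCommClass K R R] {d : R →ₗ[K] R}

/-- Every element is a sum of words `a b t₁ ⋯ tₙ` with constants `a`, `b` and `tᵢ ∈ ker d²`. -/
theorem mem_skewStar_mul_constants
    (hd : ∀ x y, d (x * y) = d x * y + x * d y)
    (hcomm : ∀ x y, d x = 0 → d y = 0 → x * y = y * x)
    (hsurj : Function.Surjective d)
    (hgen : NonUnitalAlgebra.adjoin K (LinearMap.ker (d ^ 2) : Set R) = ⊤)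
    (x : R) :
    x ∈ skewStar {c | ∃ a b, d a = 0 ∧ d b = 0 ∧ c = a * b} (LinearMap.ker (d ^ 2) : Set R) := by
  set P : Set R := {c | ∃ a b, d a = 0 ∧ d b = 0 ∧ c = a * b}
  have hP : ∀ (k : K), ∀ p ∈ P, k • p ∈ P := by
    rintro k _ ⟨a, b, ha, hb, rfl⟩
    exact ⟨k • a, b, by rw [map_smul, ha, smul_zero], hb, by rw [smul_mul_assoc]⟩
  have hleft : ∀ t : R, d (d t) = 0 → ∀ y ∈ skewStar P (LinearMap.ker (d ^ 2) : Set R),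
      t * y ∈ skewStar P (LinearMap.ker (d ^ 2) : Set R) := by
    intro t ht y hy
    induction hy using AddSubgroup.closure_induction with
    | mem y hy =>
      obtain ⟨_, ⟨a, b, ha, hb, rfl⟩, l, hl, rfl⟩ := hy
      have key : t * (a * b) = a * b * t + (t * a - a * t) * b + a * (t * b - b * t) := by
        noncomm_ring
      rw [mul_mulWord, key, mulWord_add, mulWord_add, ← mulWord_cons]
      have hmem : ∀ a b, d a = 0 → d b = 0 → a * b ∈ P := fun a b ha hb => ⟨a, b, ha, hb, rfl⟩
      refine add_mem (add_mem (mulWord_mem_skewStar (hmem a b ha hb) ?_)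
        (mulWord_mem_skewStar (hmem _ b (commutator_mem_constants hd hcomm ht ha) hb) hl))
        (mulWord_mem_skewStar (hmem a _ ha (commutator_mem_constants hd hcomm ht hb)) hl)
      simp only [List.mem_cons, forall_eq_or_imp]
      exact ⟨ht, hl⟩
    | zero => simp
    | add y z _ _ hy hz => rw [mul_add]; exact add_mem hy hz
    | neg y _ hy => rw [mul_neg]; exact neg_mem hy
  -- The clauses are proved together because d²(ty) = 2 dt dy + t d²y involves a product of a
  -- constant with dy. The first clause suffices, d² being surjective.
  have main : ∀ y : R, d (d y) ∈ skewStar P (LinearMap.ker (d ^ 2) : Set R) ∧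
      ∀ a, d a = 0 → a * d y ∈ skewStar P (LinearMap.ker (d ^ 2) : Set R) := by
    intro y
    induction y using word_induction hgen with
    | mem t ht =>
      have ht' : d (d t) = 0 := ht
      exact ⟨by rw [ht']; exact zero_mem _, fun a ha => mem_skewStar ⟨a, _, ha, ht, rfl⟩⟩
    | zero => simp
    | add y z hy hz =>
      simp only [map_add, mul_add]
      exact ⟨add_mem hy.1 hz.1, fun a ha => add_mem (hy.2 a ha) (hz.2 a ha)⟩
    | smul k y hy =>
      simp only [map_smul, mul_smul_comm]
      exact ⟨smul_mem_skewStar hP k hy.1, fun a ha => smul_mem_skewStar hP k (hy.2 a ha)⟩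
    | mul t ht y hy =>
      have ht' : d (d t) = 0 := ht
      constructor
      · have : d (d (t * y)) = d t * d y + d t * d y + t * d (d y) := by
          rw [hd, map_add, hd, hd, ht', zero_mul, zero_add, add_assoc]
        rw [this]
        exact add_mem (add_mem (hy.2 _ ht') (hy.2 _ ht')) (hleft t ht' _ hy.1)
      · intro a ha
        have : a * d (t * y) = a * d t * y + t * (a * d y) - (t * a - a * t) * d y := by
          rw [hd]
          noncomm_ring
        rw [this]
        exact sub_mem (add_mem
          (skewStar_mul_mem_of_adjoin hgen hP (mem_skewStar ⟨a, _, ha, ht', rfl⟩) y)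
          (hleft t ht' _ (hy.2 a ha))) (hy.2 _ (commutator_mem_constants hd hcomm ht' ha))
  obtain ⟨y, rfl⟩ := hsurj x
  obtain ⟨z, rfl⟩ := hsurj y
  exact (main z).1

variable [CharZero K]

/-- Nilpotent constants lie in the Jacobson radical. -/
theorem inr_mem_jacobson_of_mem_nilConstants
    (hd : ∀ x y, d (x * y) = d x * y + x * d y)
    (hcomm : ∀ x y, d x = 0 → d y = 0 → x * y = y * x)
    (hgen : NonUnitalAlgebra.adjoin K (LinearMap.ker (d ^ 2) : Set R) = ⊤)
    {p : R} (hp : p ∈ nilConstants d) :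
    (p : Unitization K R) ∈ Ideal.jacobson (⊥ : Ideal (Unitization K R)) := by
  refine Ideal.mem_jacobson_iff.2 fun y => ?_
  obtain ⟨e, he⟩ := exists_list_prod_eq_zero_of_skewStar hd hcomm
    (F := {(p : Unitization K R) * y}) (Set.finite_singleton _) (by
      rintro _ rfl
      induction y using Unitization.ind with
      | inl_add_inr k r =>
        refine ⟨k • p + p * r, add_mem (mem_skewStar (smul_mem_nilConstants k p hp))
          (skewStar_mul_mem_of_adjoin hgen smul_mem_nilConstants (mem_skewStar hp) r), ?_⟩
        simp [mul_add, Unitization.inr_mul_inl])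
  have hpow : ((p : Unitization K R) * y) ^ e = 0 := by
    simpa using he (List.replicate e ((p : Unitization K R) * y))
      (fun x hx => List.eq_of_mem_replicate hx) (by simp)
  have hnil : IsNilpotent (y * (p : Unitization K R)) :=
    ⟨e + 1, by rw [pow_succ, ← mul_assoc, mul_pow_mul, hpow, mul_zero, zero_mul]⟩
  obtain ⟨u, hu⟩ := hnil.isUnit_one_add
  refine ⟨↑u⁻¹, ?_⟩
  have hinv : (↑u⁻¹ : Unitization K R) * (1 + y * p) = 1 := by rw [← hu, Units.inv_mul]
  rw [Ideal.mem_bot, sub_eq_zero, mul_assoc]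
  rw [mul_add, mul_one, add_comm] at hinv
  exact hinv

/-- Leading coefficients of elements of the Jacobson radical are nilpotent. -/
theorem leadingCoeff_mem_nilConstants
    (hd : ∀ x y, d (x * y) = d x * y + x * d y)
    (hcomm : ∀ x y, d x = 0 → d y = 0 → x * y = y * x)
    (hsurj : Function.Surjective d)
    (hnil : ∀ r, ∃ n : ℕ, (d ^ n) r = 0)
    {r : R} {n : ℕ}
    (hr : (r : Unitization K R) ∈ Ideal.jacobson (⊥ : Ideal (Unitization K R)))
    (hn : (d ^ (n + 1)) r = 0) : (d ^ n) r ∈ nilConstants d := by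
  refine ⟨by rwa [pow_succ', Module.End.mul_apply] at hn, ?_⟩
  rcases n with _ | n
  -- A constant r has degree 0, outside the range of `isNilpotent_leadingCoeff`. With r = dt, the
  -- element rt of the radical has degree at most 1 and leading coefficient r².
  · have hr0 : d r = 0 := by simpa using hn
    obtain ⟨t, rfl⟩ := hsurj r
    obtain ⟨y, hy⟩ := exists_add_add_mul_eq_zero (K := K) (x := d t * t)
      (by rw [Unitization.inr_mul]; exact Ideal.mul_mem_right _ _ hr)
    have := isNilpotent_leadingCoeff hd hcomm hnil hy le_rfl
      (by rw [pow_apply_constant_mul hd hr0]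
          rw [show (d ^ (1 + 1)) t = 0 from hr0, mul_zero])
    rw [pow_one, hd, hr0, zero_mul, zero_add, Unitization.inr_mul, ← sq] at this
    exact this.of_pow
  · obtain ⟨y, hy⟩ := exists_add_add_mul_eq_zero hr
    exact isNilpotent_leadingCoeff hd hcomm hnil hy (by omega) hn

/-- `R J ⊆ N⟨T⟩*` for the Jacobson radical `J` and the set `N` of nilpotent constants. -/
theorem mul_mem_skewStar_of_mem_jacobson
    (hd : ∀ x y, d (x * y) = d x * y + x * d y)
    (hcomm : ∀ x y, d x = 0 → d y = 0 → x * y = y * x)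
    (hsurj : Function.Surjective d)
    (hgen : NonUnitalAlgebra.adjoin K (LinearMap.ker (d ^ 2) : Set R) = ⊤)
    (hnil : ∀ r, ∃ n : ℕ, (d ^ n) r = 0)
    (n : ℕ) {r : R}
    (hr : (r : Unitization K R) ∈ Ideal.jacobson (⊥ : Ideal (Unitization K R)))
    (hn : (d ^ n) r = 0) (s : R) :
    s * r ∈ skewStar (nilConstants d) (LinearMap.ker (d ^ 2) : Set R) := by
  induction n generalizing r s with
  | zero =>
    obtain rfl : r = 0 := hn
    simp
  | succ n ih =>
    have hab : ∀ a b : R, d a = 0 → d b = 0 → ∀ r : R,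
        (r : Unitization K R) ∈ Ideal.jacobson (⊥ : Ideal (Unitization K R)) →
        (d ^ (n + 1)) r = 0 →
        a * b * r ∈ skewStar (nilConstants d) (LinearMap.ker (d ^ 2) : Set R) := by
      intro a b ha hb r hr hn
      obtain ⟨u, hu⟩ : ∃ u, (d ^ n) u = b := by
        rw [Module.End.coe_pow]; exact hsurj.iterate n b
      have hp := leadingCoeff_mem_nilConstants hd hcomm hsurj hnil hr hn
      have hpJ := inr_mem_jacobson_of_mem_nilConstants hd hcomm hgen hp
      -- Both br and pu, where p = d^n(r), have d^n equal to bp, so the difference has smaller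
      -- degree. It stays in the radical because p does. The spare constant a is the left factor
      -- demanded by the induction hypothesis.
      have hlow := ih (r := b * r - (d ^ n) r * u)
        (by
          rw [Unitization.inr_sub, Unitization.inr_mul, Unitization.inr_mul]
          exact sub_mem (Ideal.mul_mem_left _ _ hr) (Ideal.mul_mem_right _ _ hpJ))
        (by
          rw [map_sub, pow_apply_constant_mul hd hb, pow_apply_constant_mul hd hp.1, hu,
            hcomm _ _ hb hp.1, sub_self]) a
      rw [show a * b * r = a * (b * r - (d ^ n) r * u) + (d ^ n) r * (a * u) by
        rw [← mul_assoc _ a, ← hcomm _ _ ha hp.1]; noncomm_ring]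
      exact add_mem hlow (skewStar_mul_mem_of_adjoin hgen smul_mem_nilConstants (mem_skewStar hp) _)
    have hs := mem_skewStar_mul_constants hd hcomm hsurj hgen s
    induction hs using AddSubgroup.closure_induction with
    | mem s hs =>
      obtain ⟨_, ⟨a, b, ha, hb, rfl⟩, l, hl, rfl⟩ := hs
      induction l using List.reverseRecOn generalizing r with
      | nil => exact hab a b ha hb r hr hn
      | append_singleton l t ihl =>
        have ht : d (d t) = 0 := hl t (by simp)
        have hl' : ∀ s ∈ l, s ∈ (LinearMap.ker (d ^ 2) : Set R) := fun s hs => hl s (by simp [hs])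
        -- The last letter moves past r: the right ideal absorbs t, and [t,r] is again in the
        -- radical without higher degree.
        rw [mulWord_concat, show mulWord (a * b) l * t * r =
          mulWord (a * b) l * r * t + mulWord (a * b) l * (t * r - r * t) by noncomm_ring]
        refine add_mem (skewStar_mul_mem (ihl hr hn hl') ht) (ihl ?_ ?_ hl')
        · rw [Unitization.inr_sub, Unitization.inr_mul, Unitization.inr_mul]
          exact sub_mem (Ideal.mul_mem_left _ _ hr) (Ideal.mul_mem_right _ _ hr)
        · exact pow_apply_commutator hd hcomm ht hn
    | zero => simp
    | add y z _ _ hy hz => rw [add_mul]; exact add_mem hy hz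
    | neg y _ hy => rw [neg_mul]; exact neg_mem hy

end Main

theorem exists_pairing {S : Type*} [Ring S] {F : Set S} (n : ℕ) (L : List S) (hL : ∀ x ∈ L, x ∈ F)
    (hlen : L.length = 2 * n) :
    ∃ L' : List S, (∀ x ∈ L', x ∈ Set.image2 (· * ·) F F) ∧ L'.length = n ∧ L'.prod = L.prod := by
  induction n generalizing L with
  | zero =>
    obtain rfl : L = [] := List.length_eq_zero_iff.1 hlen
    exact ⟨[], by simp, rfl, rfl⟩
  | succ n ih =>
    match L, hL, hlen with
    | [], _, hlen => simp at hlen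
    | [_], _, hlen => simp at hlen; omega
    | x :: y :: L, hL, hlen =>
      obtain ⟨L', hL', hlen', hprod⟩ := ih L (fun z hz => hL z (by simp [hz]))
        (by simp only [List.length_cons] at hlen; omega)
      refine ⟨x * y :: L', ?_, by simp [hlen'], by simp [hprod, mul_assoc]⟩
      simp only [List.mem_cons, forall_eq_or_imp]
      exact ⟨⟨x, hL x (by simp), y, hL y (by simp), rfl⟩, hL'⟩

theorem theoremB {K R : Type*} [Field K] [CharZero K] [NonUnitalRing R] [Module K R]
    [IsScalarTower K R R] [SMulCommClass K R R]
    (d : R →ₗ[K] R) (hd : ∀ x y, d (x * y) = d x * y + x * d y)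
    (hsurj : Function.Surjective d)
    (hnil : ∀ r, ∃ n : ℕ, (d ^ n) r = 0)
    (hgen : NonUnitalAlgebra.adjoin K (LinearMap.ker (d ^ 2) : Set R) = ⊤)
    (hcomm : ∀ x ∈ constants d hd, ∀ y ∈ constants d hd, x * y = y * x) :
    IsLocallyNilpotent (jacobsonRadical R) ∧
      ∀ a ∈ jacobsonRadical R, ∀ b ∈ jacobsonRadical R,
        a * b ∈ skewStar ((fun p : constants d hd => (p : R)) '' {p | p ∈ primeRadical (constants d hd)})
          (LinearMap.ker (d ^ 2) : Set R) := by
  have hcomm' : ∀ x y, d x = 0 → d y = 0 → x * y = y * x := fun x y hx hy => hcomm x hx y hy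
  have hmul : ∀ a, ∀ b ∈ jacobsonRadical R,
      a * b ∈ skewStar (nilConstants d) (LinearMap.ker (d ^ 2) : Set R) := fun a b hb =>
    (hnil b).elim fun n hn => mul_mem_skewStar_of_mem_jacobson hd hcomm' hsurj hgen hnil n
      (inr_mem_jacobson_of_mem_jacobsonRadical hb) hn a
  refine ⟨fun F hF => ?_, fun a _ b hb => ?_⟩
  · let G : Set (Unitization K R) := (↑) '' (F : Set R)
    have hG : G.Finite := F.finite_toSet.image _
    -- Only products of two elements of J are known to lie in N⟨T⟩*, so factors are grouped in
    -- pairs; this is the source of the bound 2e.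
    obtain ⟨e, he⟩ := exists_list_prod_eq_zero_of_skewStar hd hcomm' (hG.image2 (· * ·) hG) (by
      rintro _ ⟨_, ⟨x, hx, rfl⟩, _, ⟨y, hy, rfl⟩, rfl⟩
      exact ⟨x * y, hmul x y (hF y hy), (Unitization.inr_mul K x y).symm⟩)
    have hG0 : ∀ L : List (Unitization K R), (∀ x ∈ L, x ∈ G) → L.length = 2 * e → L.prod = 0 := by
      intro L hL hlen
      obtain ⟨L', hL', hlen', hprod⟩ := exists_pairing e L hL hlen
      rw [← hprod, he L' hL' hlen']
    have hmem : ∀ x ∈ NonUnitalSubring.closure (F : Set R),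
        (x : Unitization K R) ∈ NonUnitalSubring.closure G := by
      intro x hx
      induction hx using NonUnitalSubring.closure_induction with
      | mem x hx => exact NonUnitalSubring.subset_closure ⟨x, hx, rfl⟩
      | zero => rw [Unitization.inr_zero]; exact zero_mem _
      | add x y _ _ hx hy => rw [Unitization.inr_add]; exact add_mem hx hy
      | neg x _ hx => rw [Unitization.inr_neg]; exact neg_mem hx
      | mul x y _ _ hx hy => rw [Unitization.inr_mul]; exact mul_mem hx hy
    refine ⟨2 * e, fun s hs l hl hlen => ?_⟩
    apply Unitization.inr_injective (R := K)
    rw [inr_mulWord, Unitization.inr_zero,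
      list_prod_eq_zero_of_mem_closure hG0 (l.map (↑)) (fun x hx => ?_) (by simpa using hlen), mul_zero]
    obtain ⟨y, hy, rfl⟩ := List.mem_map.1 hx
    exact hmem y (hl y hy)
  · rw [image_primeRadical_eq hd hcomm']
    exact hmul a b hb
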